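/- Let $\Gamma$ be a finite bipartite graph (multiple edges are allowed) with colour classes $B$ and $W$, $|B|=|W|=n$, and edge set $E$, together with an embedding in the plane, that is, a rotation system (a cyclic order of the edges at each vertex) for which every connected component containing an edge satisfies Euler's formula $V-E+F=2$; here the faces are the closed facial walks (boundary walks) determined by the rotation system. The length of a face is the length of its facial walk, so an edge that the walk passes twice counts twice. Let $\kappa:E\to\{+1,-1\}$ be a Kasteleyn weighting: the number of edges $\varepsilon$ with $\kappa(\varepsilon)=-1$ around each face, counted with the same multiplicity, is odd if the length of the face is $0$ mod $4$, and even if it is $2$ mod $4$. (If $\Gamma$ is connected these are the faces of the plane graph in the usual sense; if $\Gamma$ is disconnected the condition is imposed on each facial walk separately.) Number the vertices as $B=\{b_1,\dots,b_n\}$ and $W=\{w_1,\dots,w_n\}$ in any way, let $(x_\varepsilon)_{\varepsilon\in E}$ be independent formal variables, and let $M=(m_{ij})$ be the signed bipartite adjacency submatrix $$m_{ij}=\sum_{\varepsilon\text{ joins }b_i\text{ and }w_j}\kappa(\varepsilon)\,x_\varepsilon\in\mathbb Z[x_\varepsilon:\varepsilon\in E].$$ For a permutation $\sigma\in S_n$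 let $t_\sigma=\operatorname{sgn}(\sigma)\prod_{i=1}^n m_{i\sigma(i)}$ be its term in the expansion $\det M=\sum_{\sigma\in S_n} t_\sigma$, and say that a perfect matching $\mu\subseteq E$ induces $\sigma$ if every edge of $\mu$ joins $b_i$ to $w_{\sigma(i)}$ for some $i$. Then 1. $t_\sigma\neq0$ if and only if some perfect matching of $\Gamma$ induces $\sigma$, and every perfect matching induces exactly one permutation; 2. there is one overall sign $\epsilon\in\{+1,-1\}$ such that for every $\sigma\in S_n$ $$t_\sigma=\epsilon\sum_{\mu\text{ inducing }\sigma}\ \prod_{\varepsilon\in\mu}x_\varepsilon,\qquad\text{hence}\qquad \det M=\epsilon\sum_{\mu}\ \prod_{\varepsilon\in\mu}x_\varepsilon,$$ the last sum being over all perfect matchings $\mu$ of $\Gamma$. If $\Gamma$ has no multiple edges, then for every $\sigma$ with $t_\sigma\ne0$ there is exactly one perfect matching $\mu$ inducing $\sigma$, and $t_\sigma=\epsilon\prod_{\varepsilon\in\mu}x_\varepsilon$; so the non-zero terms correspond one-to-one to the perfect matchings. -/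

import Mathlib

open scoped BigOperators

/-- A bipartite graph with colour classes `B` (the first vertex set) and `W` (the second vertex
set) and edge set `E`. Each edge joins its end in `B` to its end in `W`; several edges may have the
same two ends. -/
structure BipartiteGraph (B W E : Type*) where
  black : E → B
  white : E → W

namespace BipartiteGraph

variable {B W E : Type*}

/-- No two different edges have the same two ends. -/
def IsSimple (G : BipartiteGraph B W E) : Prop :=
  ∀ e e' : E, G.black e = G.black e' → G.white e = G.white e' → e = e'

/-- The underlying simple graph on the set of all vertices; it is used only to speak of connected
components. -/
def toSimpleGraph (G : BipartiteGraph B W E) : SimpleGraph (B ⊕ W) :=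
  SimpleGraph.fromRel fun u v => ∃ e : E, u = Sum.inl (G.black e) ∧ v = Sum.inr (G.white e)

/-- The darts (edges with a direction) are the pairs in `E × Bool`: `(e, false)` is the edge `e`
directed away from its end in `B`, and `(e, true)` is `e` directed away from its end in `W`.
This is the vertex from which a dart starts. -/
def origin (G : BipartiteGraph B W E) : E × Bool → B ⊕ W
  | (e, false) => Sum.inl (G.black e)
  | (e, true) => Sum.inr (G.white e)

/-- The reversal of darts. -/
def reversal (E : Type*) : Equiv.Perm (E × Bool) :=
  Equiv.prodCongr (Equiv.refl E) Equiv.boolNot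

/-- A rotation system: a permutation of the darts whose cycles are exactly the sets of darts that
start from a common vertex. It gives, at every vertex, the (say counterclockwise) cyclic order of
the edges at that vertex in a drawing on an oriented surface. -/
structure RotationSystem (G : BipartiteGraph B W E) where
  next : Equiv.Perm (E × Bool)
  sameCycle_iff : ∀ d d' : E × Bool, next.SameCycle d d' ↔ G.origin d = G.origin d'

namespace RotationSystem

variable {G : BipartiteGraph B W E}

/-- The facial walk: traverse a dart to its end, then leave that vertex along the edge which comes
next in the rotation. -/
def facePerm (R : G.RotationSystem) : Equiv.Perm (E × Bool) :=
  R.next * reversal E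

/-- The faces, as cyclic facial walks, that is, as orbits of `facePerm`. -/
def Face (R : G.RotationSystem) : Type _ :=
  Quotient (Equiv.Perm.SameCycle.setoid R.facePerm)

/-- The face that a dart runs along. -/
def faceOf (R : G.RotationSystem) (d : E × Bool) : R.Face :=
  Quotient.mk (Equiv.Perm.SameCycle.setoid R.facePerm) d

/-- The length of a face: the length of its facial walk. An edge which the walk passes on both of
its sides counts twice. -/
noncomputable def faceLength (R : G.RotationSystem) (F : R.Face) : ℕ :=
  Nat.card {d : E × Bool // R.faceOf d = F}

/-- The number of negative edges around a face, for a choice `κ` of signs of the edges, counted in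
the same way as in `faceLength`. -/
noncomputable def negatives (R : G.RotationSystem) (κ : E → ℤˣ) (F : R.Face) : ℕ :=
  Nat.card {d : E × Bool // R.faceOf d = F ∧ κ d.1 = -1}

/-- The rotation system describes an embedding in the plane (equivalently, in the sphere): every
connected component `K` that has an edge satisfies Euler's formula `V - E + F = 2`, where `V`, `E`
and `F` are its numbers of vertices, edges and faces. An isolated vertex is no restriction. -/
def IsPlane (R : G.RotationSystem) : Prop :=
  ∀ K : G.toSimpleGraph.ConnectedComponent,
    (∃ e : E, G.toSimpleGraph.connectedComponentMk (Sum.inl (G.black e)) = K) →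
    Nat.card {v : B ⊕ W // G.toSimpleGraph.connectedComponentMk v = K} +
        Nat.card {F : R.Face //
          ∃ d, R.faceOf d = F ∧ G.toSimpleGraph.connectedComponentMk (G.origin d) = K} =
      Nat.card {e : E // G.toSimpleGraph.connectedComponentMk (Sum.inl (G.black e)) = K} + 2

/-- A Kasteleyn weighting: a choice of sign for each edge such that the number of negatives around
each face is odd if the face has length `0 mod 4` and even if the face has length `2 mod 4`.
(Every face of a bipartite graph has even length.) -/
def IsKasteleyn (R : G.RotationSystem) (κ : E → ℤˣ) : Prop :=
  ∀ F : R.Face,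
    (R.faceLength F % 4 = 0 → Odd (R.negatives κ F)) ∧
      (R.faceLength F % 4 = 2 → Even (R.negatives κ F))

end RotationSystem

/-- A perfect matching: a set of edges such that every vertex is the end of exactly one of them. -/
def IsPerfectMatching (G : BipartiteGraph B W E) (μ : Finset E) : Prop :=
  (∀ b : B, ∃! e : E, e ∈ μ ∧ G.black e = b) ∧ (∀ w : W, ∃! e : E, e ∈ μ ∧ G.white e = w)

/-- The set of edges `μ` joins the `i`-th vertex of the first vertex set to the `σ i`-th vertex of
the second, and contains no other edges. Here the vertices of the two sets are numbered by `β` and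
`ω`. -/
def MatchesVia {n : ℕ} (G : BipartiteGraph B W E) (β : Fin n ≃ B) (ω : Fin n ≃ W)
    (σ : Equiv.Perm (Fin n)) (μ : Finset E) : Prop :=
  ∀ e ∈ μ, ∃ i : Fin n, G.black e = β i ∧ G.white e = ω (σ i)

/-- All perfect matchings. -/
noncomputable def perfectMatchings [Fintype E] (G : BipartiteGraph B W E) : Finset (Finset E) :=
  open Classical in Finset.univ.filter fun μ => G.IsPerfectMatching μ

/-- The perfect matchings that match the `i`-th vertex of the first vertex set to the `σ i`-th
vertex of the second vertex set, for all `i`. Without multiple edges there is at most one. -/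
noncomputable def perfectMatchingsVia [Fintype E] {n : ℕ} (G : BipartiteGraph B W E)
    (β : Fin n ≃ B) (ω : Fin n ≃ W) (σ : Equiv.Perm (Fin n)) : Finset (Finset E) :=
  open Classical in G.perfectMatchings.filter fun μ => G.MatchesVia β ω σ μ

/-- The (unsigned) monomial of a set of edges: the product of their formal variables. -/
noncomputable def monomial (μ : Finset E) : MvPolynomial E ℤ :=
  ∏ e ∈ μ, MvPolynomial.X e

/-- The signed bipartite adjacency submatrix, with the formal variable `X e` in place of the usual
`1` for each edge `e`, and with the signs `κ`. The rows are the vertices of the first vertex set and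
the columns those of the second, in the orders `β` and `ω`; multiple edges are added up. -/
noncomputable def signedMatrix [Fintype E] {n : ℕ} (G : BipartiteGraph B W E)
    (κ : E → ℤˣ) (β : Fin n ≃ B) (ω : Fin n ≃ W) :
    Matrix (Fin n) (Fin n) (MvPolynomial E ℤ) :=
  open Classical in fun i j =>
    ∑ e ∈ Finset.univ.filter (fun e : E => G.black e = β i ∧ G.white e = ω j),
      MvPolynomial.C ((κ e : ℤˣ) : ℤ) * MvPolynomial.X e

end BipartiteGraph

/-- The term of the permutation `σ` in the determinant expansion of the matrix `M`. -/
def detTerm {n : ℕ} {R : Type*} [CommRing R] (M : Matrix (Fin n) (Fin n) R)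
    (σ : Equiv.Perm (Fin n)) : R :=
  ((Equiv.Perm.sign σ : ℤˣ) : ℤ) * ∏ i, M i (σ i)

/-- The determinant is the sum of these terms. -/
theorem det_eq_sum_detTerm {n : ℕ} {R : Type*} [CommRing R] (M : Matrix (Fin n) (Fin n) R) :
    M.det = ∑ σ : Equiv.Perm (Fin n), detTerm M σ := by
  rw [← Matrix.det_transpose, Matrix.det_apply']
  rfl

/-! Expanding entries turns `t_σ` into a sum over matchings inducing `σ`, each with sign `sign σ * ∏
κ`. It remains to show that this sign is the same for any two perfect matchings `μ`, `μ'`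
(`sign_mul_prod_eq`).

Let `τ` be the rotation and `α` the reversal of darts; faces are the cycles of `τ * α`. Giving the
two darts of an edge opposite signs `±κ` makes the Kasteleyn condition say that the product along
every face is `-1`. The darts outside `μ ∪ μ'` are then detached one by one, each becoming a new
vertex of degree one. A perfect matching is a set `m` of darts meeting each vertex once; a detached
dart is added to `m`, and `twist` corrects the signs where an edge lies only half in `m`. All face
products stay `-1` (`cycleProd_twist_detach`): by planarity each component acquires at most one new
face (`IsPlanar.detach`), and the others determine its product by Euler's formula mod 2
(`cycleProd_twist_eq_of_forall`).

In the end the faces that leave `B` along `μ` and `W` along `μ'` are the cycles of a permutation of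
`2n` points of sign `(-1)^n * sign σ * sign σ'`. Since every cycle has product `-1`, that sign is
also the product of all dart signs, `(-1)^n * ∏_μ κ * ∏_μ' κ`. Comparison gives the claim
(`sign_mul_prod_eq`). -/

/-! ### Equivalence relations with two classes united. -/

namespace Setoid

variable {D : Type*}

/-- The equivalence relation obtained from `r` by uniting the classes of `x` and `y`. -/
def merge (r : Setoid D) (x y : D) : Setoid D where
  r a b := r a b ∨ (r a x ∨ r a y) ∧ (r b x ∨ r b y)
  iseqv := by
    refine ⟨fun a => Or.inl (r.refl a), ?_, ?_⟩
    · rintro a b (h | ⟨h, h'⟩)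
      · exact Or.inl (r.symm h)
      · exact Or.inr ⟨h', h⟩
    · rintro a b c (h | ⟨h, h'⟩) (k | ⟨k, k'⟩)
      · exact Or.inl (r.trans h k)
      · exact Or.inr ⟨k.imp (r.trans h) (r.trans h), k'⟩
      · exact Or.inr ⟨h, h'.imp (r.trans (r.symm k)) (r.trans (r.symm k))⟩
      · exact Or.inr ⟨h, k'⟩

theorem merge_apply {r : Setoid D} {x y a b : D} :
    r.merge x y a b ↔ r a b ∨ (r a x ∨ r a y) ∧ (r b x ∨ r b y) := Iff.rfl

theorem le_merge (r : Setoid D) (x y : D) : r ≤ r.merge x y := fun _ _ h => Or.inl h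

theorem merge_pair (r : Setoid D) (x y : D) : r.merge x y x y :=
  Or.inr ⟨Or.inl (r.refl x), Or.inr (r.refl y)⟩

theorem merge_le_iff {r t : Setoid D} {x y : D} : r.merge x y ≤ t ↔ r ≤ t ∧ t x y := by
  refine ⟨fun h => ⟨(le_merge r x y).trans h, h (merge_pair r x y)⟩, ?_⟩
  rintro ⟨h, hxy⟩ a b (k | ⟨k, k'⟩)
  · exact h k
  · have key : ∀ c, r c x ∨ r c y → t c x := fun c hc =>
      hc.elim (fun e => h e) fun e => t.trans (h e) (t.symm hxy)
    exact t.trans (key a k) (t.symm (key b k'))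

theorem merge_eq_self {r : Setoid D} {x y : D} (h : r x y) : r.merge x y = r :=
  le_antisymm (merge_le_iff.2 ⟨le_rfl, h⟩) (le_merge r x y)

theorem merge_sup (r t : Setoid D) (x y : D) : r.merge x y ⊔ t = (r ⊔ t).merge x y := by
  refine le_antisymm (sup_le (merge_le_iff.2 ⟨?_, merge_pair _ x y⟩) ?_) (merge_le_iff.2 ⟨?_, ?_⟩)
  · exact le_sup_left.trans (le_merge _ x y)
  · exact le_sup_right.trans (le_merge _ x y)
  · exact sup_le_sup_right (le_merge r x y) t
  · exact (le_sup_left : r.merge x y ≤ r.merge x y ⊔ t) (merge_pair r x y)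

/-- The number of classes of an equivalence relation. -/
noncomputable def numClasses (r : Setoid D) : ℕ := Nat.card (Quotient r)

theorem numClasses_eq_sum [Finite D] {r t : Setoid D} [Fintype (Quotient t)]
    (h : r ≤ t) :
    r.numClasses = ∑ q, Nat.card {p : Quotient r // Quotient.map' id (fun _ _ e => h e) p = q} := by
  have := Fintype.ofFinite (Quotient r)
  rw [numClasses, ← Nat.card_sigma]
  exact Nat.card_congr (Equiv.sigmaFiberEquiv _).symm

theorem numClasses_merge [Finite D] {r : Setoid D} {x y : D} (h : ¬ r x y) :
    (r.merge x y).numClasses + 1 = r.numClasses := by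
  classical
  have := Fintype.ofFinite (Quotient r)
  -- The class of `y` is absorbed by that of `x`; all other classes survive unchanged.
  let f : {q : Quotient r // q ≠ Quotient.mk r y} → Quotient (r.merge x y) := fun q =>
    Quotient.map' id (fun _ _ h => le_merge r x y h) q.1
  have hf : Function.Bijective f := by
    constructor
    · rintro ⟨p, hp⟩ ⟨q, hq⟩ hpq
      induction p using Quotient.inductionOn with | h a => ?_
      induction q using Quotient.inductionOn with | h b => ?_
      have ha : ¬ r a y := fun e => hp (Quotient.sound e)
      have hb : ¬ r b y := fun e => hq (Quotient.sound e)
      have hab : r.merge x y a b := Quotient.exact hpq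
      rcases hab with e | ⟨e, e'⟩
      · exact Subtype.ext (Quotient.sound e)
      · exact Subtype.ext (Quotient.sound
          (r.trans (e.resolve_right ha) (r.symm (e'.resolve_right hb))))
    · intro q
      induction q using Quotient.inductionOn with | h a => ?_
      by_cases ha : r a y
      · refine ⟨⟨Quotient.mk r x, fun e => h (Quotient.exact e)⟩, Quotient.sound ?_⟩
        exact Or.inr ⟨Or.inl (r.refl x), Or.inr ha⟩
      · exact ⟨⟨Quotient.mk r a, fun e => ha (Quotient.exact e)⟩, rfl⟩
  have hc := Nat.card_eq_of_bijective f hf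
  unfold numClasses
  rw [← hc, Nat.card_eq_fintype_card, Nat.card_eq_fintype_card, Fintype.card_subtype_compl,
    Fintype.card_subtype_eq]
  have : 0 < Fintype.card (Quotient r) := Fintype.card_pos_iff.2 ⟨Quotient.mk r x⟩
  omega

end Setoid

/-! ### Cycles of a permutation multiplied by a transposition. -/

namespace Equiv.Perm

variable {D : Type*}

theorem SameCycle.setoid_apply {f : Perm D} {a b : D} :
    SameCycle.setoid f a b ↔ f.SameCycle a b := Iff.rfl

theorem sameCycleSetoid_le_iff {f : Perm D} {t : Setoid D} :
    SameCycle.setoid f ≤ t ↔ ∀ a, t a (f a) := by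
  refine ⟨fun h a => h (SameCycle.setoid_apply.2 ⟨1, by simp⟩), fun h a b hab => ?_⟩
  obtain ⟨k, rfl⟩ := hab
  induction k with
  | zero => exact t.refl a
  | succ k ih =>
    have := h ((f ^ (k : ℤ)) a)
    rw [← Perm.mul_apply, ← zpow_one_add, add_comm] at this
    exact t.trans ih this
  | pred k ih =>
    have := h ((f ^ (-(k : ℤ) - 1)) a)
    rw [← Perm.mul_apply, ← zpow_one_add, add_sub_cancel] at this
    exact t.trans ih (t.symm this)

theorem sameCycle_of_apply_eq_self {f : Perm D} {x b : D} (hx : f x = x) :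
    f.SameCycle x b ↔ b = x := by
  refine ⟨?_, fun h => h ▸ SameCycle.refl f x⟩
  rintro ⟨k, rfl⟩
  exact zpow_apply_eq_self_of_apply_eq_self hx k

/-- The number of cycles, fixed points included. -/
noncomputable def numCycles (f : Perm D) : ℕ := (SameCycle.setoid f).numClasses

theorem numCycles_one : (1 : Perm D).numCycles = Nat.card D := by
  refine (Nat.card_eq_of_bijective (Quotient.mk (SameCycle.setoid (1 : Perm D)))
    ⟨fun a b hab => ?_, Quotient.mk_surjective⟩).symm
  have := Quotient.exact hab
  exact sameCycle_one.1 this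

variable [DecidableEq D]

theorem setoid_le_merge_swap_mul (f : Perm D) (x y : D) :
    SameCycle.setoid f ≤ (SameCycle.setoid (swap x y * f)).merge x y := by
  refine sameCycleSetoid_le_iff.2 fun a => ?_
  have h1 : (SameCycle.setoid (swap x y * f)) a (swap x y (f a)) :=
    SameCycle.setoid_apply.2 ⟨1, by simp⟩
  rcases eq_or_ne (f a) x with hx | hx
  · rw [hx, swap_apply_left] at h1
    exact Or.inr ⟨Or.inr h1, Or.inl (hx ▸ Setoid.refl' _ _)⟩
  · rcases eq_or_ne (f a) y with hy | hy
    · rw [hy, swap_apply_right] at h1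
      exact Or.inr ⟨Or.inl h1, Or.inr (hy ▸ Setoid.refl' _ _)⟩
    · rw [swap_apply_of_ne_of_ne hx hy] at h1
      exact Or.inl h1

theorem setoid_swap_mul_le_merge (f : Perm D) (x y : D) :
    SameCycle.setoid (swap x y * f) ≤ (SameCycle.setoid f).merge x y := by
  simpa [← mul_assoc] using setoid_le_merge_swap_mul (swap x y * f) x y

/-- From `y`, the new permutation follows the old cycle of `y` until that is about to close, and
then jumps to `x`. If it never jumped, the old cycle would never close, against finite order. -/
theorem sameCycle_swap_mul [Finite D] {f : Perm D} {x y : D} (h : ¬ f.SameCycle x y) :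
    (swap x y * f).SameCycle x y := by
  by_contra hg
  have hxy : x ≠ y := fun e => h (e ▸ SameCycle.refl f x)
  have key : ∀ k : ℕ, ((swap x y * f) ^ k) y = (f ^ k) y ∧ (f ^ (k + 1)) y ≠ y := by
    have step : ∀ k : ℕ, ((swap x y * f) ^ k) y = (f ^ k) y → (f ^ (k + 1)) y ≠ y := by
      intro k hk e
      refine hg (SameCycle.symm ⟨(k + 1 : ℕ), ?_⟩)
      rw [zpow_natCast, pow_succ', Perm.mul_apply, hk, Perm.mul_apply, ← Perm.mul_apply f,
        ← pow_succ', e, swap_apply_right]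
    intro k
    induction k with
    | zero => exact ⟨rfl, step 0 rfl⟩
    | succ k ih =>
      have : ((swap x y * f) ^ (k + 1)) y = (f ^ (k + 1)) y := by
        rw [pow_succ', Perm.mul_apply, ih.1, Perm.mul_apply, ← Perm.mul_apply f, ← pow_succ',
          swap_apply_of_ne_of_ne _ ih.2]
        exact fun e => h (SameCycle.symm ⟨(k + 1 : ℕ), by rw [zpow_natCast, e]⟩)
      exact ⟨this, step _ this⟩
  have h0 : 0 < orderOf f := orderOf_pos f
  refine (key (orderOf f - 1)).2 ?_
  rw [Nat.sub_add_cancel h0, pow_orderOf_eq_one, Perm.one_apply]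

theorem setoid_swap_mul [Finite D] {f : Perm D} {x y : D} (h : ¬ f.SameCycle x y) :
    SameCycle.setoid (swap x y * f) = (SameCycle.setoid f).merge x y :=
  le_antisymm (setoid_swap_mul_le_merge f x y) <| Setoid.merge_eq_self
    (r := SameCycle.setoid (swap x y * f)) (sameCycle_swap_mul h) ▸
      Setoid.merge_le_iff.2 ⟨setoid_le_merge_swap_mul f x y, Setoid.merge_pair _ x y⟩

theorem numCycles_swap_mul [Finite D] {f : Perm D} {x y : D} (h : ¬ f.SameCycle x y) :
    (swap x y * f).numCycles + 1 = f.numCycles := by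
  rw [numCycles, setoid_swap_mul h]
  exact Setoid.numClasses_merge h

/-- Removal of `x` from its cycle. -/
def detach (f : Perm D) (x : D) : Perm D := swap x (f x) * f

theorem swap_mul_detach (f : Perm D) (x : D) : swap x (f x) * f.detach x = f := by
  simp [detach, ← mul_assoc]

theorem detach_apply_self (f : Perm D) (x : D) : f.detach x x = x := by simp [detach]

theorem not_sameCycle_detach {f : Perm D} {x : D} (h : f x ≠ x) :
    ¬ (f.detach x).SameCycle x (f x) := by
  rwa [sameCycle_of_apply_eq_self (detach_apply_self f x)]

theorem setoid_detach [Finite D] {f : Perm D} {x : D} (h : f x ≠ x) :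
    SameCycle.setoid f = (SameCycle.setoid (f.detach x)).merge x (f x) := by
  rw [← setoid_swap_mul (not_sameCycle_detach h), swap_mul_detach]

theorem numCycles_detach [Finite D] {f : Perm D} {x : D} (h : f x ≠ x) :
    (f.detach x).numCycles = f.numCycles + 1 := by
  rw [← numCycles_swap_mul (not_sameCycle_detach h), swap_mul_detach]

theorem detach_mul (f g : Perm D) (x : D) : f.detach x * g = swap x (f x) * (f * g) := by
  rw [detach, mul_assoc]

theorem induction_detach [Fintype D] {p : Perm D → Prop} (h1 : p 1)
    (h : ∀ f x, f x ≠ x → p (f.detach x) → p f) (f : Perm D) : p f := by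
  induction hn : f.support.card using Nat.strong_induction_on generalizing f with
  | _ n ih =>
    by_cases hf : f = 1
    · exact hf ▸ h1
    · obtain ⟨x, hx⟩ : ∃ x, f x ≠ x := by
        by_contra! hx
        exact hf (Perm.ext hx)
      exact h f x hx (ih _ (hn ▸ card_support_swap_mul hx) _ rfl)

theorem sign_eq_neg_one_pow [Fintype D] (f : Perm D) :
    sign f = (-1) ^ (Fintype.card D + f.numCycles) := by
  refine induction_detach
    (p := fun f => sign f = (-1) ^ (Fintype.card D + f.numCycles)) ?_ ?_ f
  · rw [numCycles_one, Nat.card_eq_fintype_card, sign_one, Even.neg_one_pow ⟨_, rfl⟩]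
  · intro f x hx ih
    rw [numCycles_detach hx, detach, sign_mul, sign_swap hx.symm, ← add_assoc, pow_succ] at ih
    simpa using ih

/-- Otherwise both permutations would have the same cycle partition, hence the same sign, although
they differ by a transposition. -/
theorem not_sameCycle_swap_mul [Finite D] {f : Perm D} {x y : D} (hxy : x ≠ y)
    (h : f.SameCycle x y) : ¬ (swap x y * f).SameCycle x y := by
  intro hg
  have := Fintype.ofFinite D
  have he : SameCycle.setoid (swap x y * f) = SameCycle.setoid f := by
    refine le_antisymm ?_ ?_
    · exact (setoid_swap_mul_le_merge f x y).trans (Setoid.merge_eq_self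
        (r := SameCycle.setoid f) h).le
    · exact (setoid_le_merge_swap_mul f x y).trans (Setoid.merge_eq_self
        (r := SameCycle.setoid (swap x y * f)) hg).le
  have h1 := sign_eq_neg_one_pow (swap x y * f)
  rw [numCycles, he, ← numCycles, ← sign_eq_neg_one_pow f, sign_mul, sign_swap hxy] at h1
  simp at h1

end Equiv.Perm

/-! ### Components and genus of combinatorial maps. -/

namespace Equiv.Perm

variable {D : Type*}

/-- The orbits of the group generated by `τ` and `α`: the connected components of a combinatorial
map. -/
def orbitSetoid (τ α : Perm D) : Setoid D := SameCycle.setoid τ ⊔ SameCycle.setoid α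

theorem setoid_mul_le_orbitSetoid (τ α : Perm D) :
    SameCycle.setoid (τ * α) ≤ orbitSetoid τ α := by
  refine sameCycleSetoid_le_iff.2 fun a => ?_
  have h1 : orbitSetoid τ α a (α a) :=
    (le_sup_right : _ ≤ orbitSetoid τ α) (sameCycleSetoid_le_iff.1 le_rfl a)
  have h2 : orbitSetoid τ α (α a) (τ (α a)) :=
    (le_sup_left : _ ≤ orbitSetoid τ α) (sameCycleSetoid_le_iff.1 le_rfl _)
  exact Setoid.trans' _ h1 h2

theorem sameCycle_involution_iff {α : Perm D} (hα : ∀ a, α (α a) = a) {a b : D} :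
    α.SameCycle a b ↔ b = a ∨ b = α a := by
  constructor
  · rintro ⟨k, rfl⟩
    have h2 : α ^ (2 : ℤ) = 1 := Perm.ext fun a => hα a
    rcases Int.even_or_odd' k with ⟨j, rfl | rfl⟩
    · left; rw [zpow_mul, h2, one_zpow]; rfl
    · right; rw [zpow_add, zpow_mul, h2, one_zpow]; rfl
  · rintro (rfl | rfl)
    · exact SameCycle.refl _ _
    · exact ⟨1, by simp⟩

theorem card_le_two_mul_numCycles [Finite D] {α : Perm D} (hα : ∀ a, α (α a) = a) :
    Nat.card D ≤ 2 * α.numCycles := by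
  classical
  have := Fintype.ofFinite D
  have := Fintype.ofFinite (Quotient (SameCycle.setoid α))
  have h := Finset.card_le_mul_card_image_of_maps_to (s := (Finset.univ : Finset D))
    (t := Finset.univ) (f := Quotient.mk (SameCycle.setoid α)) (by simp) 2 ?_
  · simpa [numCycles, Setoid.numClasses, Nat.card_eq_fintype_card] using h
  · intro q _
    induction q using Quotient.inductionOn with | h a => ?_
    refine (Finset.card_le_card (t := {a, α a}) fun b hb => ?_).trans Finset.card_le_two
    have hb : α.SameCycle b a := Quotient.exact (Finset.mem_filter.1 hb).2
    simpa using (sameCycle_involution_iff hα).1 hb.symm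

section Planar

variable [DecidableEq D]

theorem orbitSetoid_detach [Finite D] {τ : Perm D} (α : Perm D) {x : D} (h : τ x ≠ x) :
    orbitSetoid τ α = (orbitSetoid (τ.detach x) α).merge x (τ x) := by
  rw [orbitSetoid, setoid_detach h, Setoid.merge_sup, orbitSetoid]

/-- The genus of a combinatorial map is nonnegative. -/
theorem numCycles_add_le [Fintype D] {α : Perm D} (hα : ∀ a, α (α a) = a)
    (τ : Perm D) :
    τ.numCycles + (τ * α).numCycles ≤ α.numCycles + 2 * (orbitSetoid τ α).numClasses := by
  refine induction_detach (p := fun τ => τ.numCycles + (τ * α).numCycles ≤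
    α.numCycles + 2 * (orbitSetoid τ α).numClasses) ?_ ?_ τ
  -- With `τ = 1` every dart is a vertex, and faces, edges and components are all the cycles of `α`.
  · have h1 : SameCycle.setoid (1 : Perm D) ≤ SameCycle.setoid α :=
      sameCycleSetoid_le_iff.2 fun a => Setoid.refl' _ a
    have h2 := card_le_two_mul_numCycles hα
    rw [orbitSetoid, sup_eq_right.2 h1, numCycles_one, one_mul]
    unfold numCycles at *
    omega
  · intro τ x hx ih
    have h1 := numCycles_detach hx
    rw [detach_mul] at ih
    have ho := orbitSetoid_detach α hx
    -- Detaching adds one vertex. If `x` and `τ x` share a face, that face splits and at most one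
    -- component is gained; otherwise two faces merge, and the merged face keeps `x` and `τ x`
    -- connected.
    by_cases hf : (τ * α).SameCycle x (τ x)
    · have h2 := numCycles_swap_mul (not_sameCycle_swap_mul hx.symm hf)
      rw [← mul_assoc, swap_mul_self, one_mul] at h2
      have h3 : (orbitSetoid (τ.detach x) α).numClasses ≤ (orbitSetoid τ α).numClasses + 1 := by
        rw [ho]
        by_cases h : orbitSetoid (τ.detach x) α x (τ x)
        · rw [Setoid.merge_eq_self h]; omega
        · exact (Setoid.numClasses_merge h).ge
      omega
    · have h2 := numCycles_swap_mul hf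
      have h3 : orbitSetoid (τ.detach x) α x (τ x) := by
        refine setoid_mul_le_orbitSetoid _ _ ?_
        rw [detach_mul]
        exact sameCycle_swap_mul hf
      rw [ho, Setoid.merge_eq_self h3]
      omega

/-- A combinatorial map with vertex rotation `τ` and edge involution `α` all of whose components
have genus zero. -/
def IsPlanar (τ α : Perm D) : Prop :=
  τ.numCycles + (τ * α).numCycles = α.numCycles + 2 * (orbitSetoid τ α).numClasses

/-- A face that splits without disconnecting its component would make the genus negative. So either
the component falls apart, or two faces merge into one containing both `x` and `τ x`. -/
theorem IsPlanar.detach [Fintype D] {τ α : Perm D} (hα : ∀ a, α (α a) = a)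
    (h : IsPlanar τ α) {x : D} (hx : τ x ≠ x) :
    IsPlanar (τ.detach x) α ∧
      (orbitSetoid (τ.detach x) α x (τ x) → (τ.detach x * α).SameCycle x (τ x)) := by
  have h1 := numCycles_detach hx
  have ho := orbitSetoid_detach α hx
  have hle := numCycles_add_le hα (τ.detach x)
  unfold IsPlanar at *
  rw [detach_mul] at *
  by_cases hf : (τ * α).SameCycle x (τ x)
  · have h2 := numCycles_swap_mul (not_sameCycle_swap_mul hx.symm hf)
    rw [← mul_assoc, swap_mul_self, one_mul] at h2
    rw [ho] at h
    by_cases h3 : orbitSetoid (τ.detach x) α x (τ x)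
    · rw [Setoid.merge_eq_self h3] at h
      omega
    · have h4 := Setoid.numClasses_merge h3
      exact ⟨by omega, fun h => absurd h h3⟩
  · have h2 := numCycles_swap_mul hf
    have h3 := sameCycle_swap_mul hf
    have h4 : orbitSetoid (τ.detach x) α x (τ x) := by
      refine setoid_mul_le_orbitSetoid _ _ ?_
      rw [detach_mul]
      exact h3
    rw [ho, Setoid.merge_eq_self h4] at h
    exact ⟨by omega, fun _ => h3⟩

theorem sameCycle_swap_mul_iff {f : Perm D} {x y a b : D}
    (hx : ¬ (swap x y * f).SameCycle a x) (hy : ¬ (swap x y * f).SameCycle a y) :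
    (swap x y * f).SameCycle a b ↔ f.SameCycle a b := by
  have key : ∀ c, f.SameCycle a c → (swap x y * f).SameCycle a c := fun c h =>
    (setoid_le_merge_swap_mul f x y h).resolve_right fun h => h.1.elim hx hy
  refine ⟨fun h => ?_, key b⟩
  exact (setoid_swap_mul_le_merge f x y h).resolve_right fun h =>
    h.1.elim (fun h => hx (key _ h)) fun h => hy (key _ h)

end Planar

/-! ### Products of signs along cycles. -/

section CycleProd

open Classical in
/-- The product of the values of `u` along the cycle of `f` that contains `a`. -/
noncomputable def cycleProd [Fintype D] (f : Perm D) (u : D → ℤˣ) (a : D) : ℤˣ :=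
  ∏ b with f.SameCycle a b, u b

theorem cycleProd_congr [Fintype D] {f g : Perm D} {u v : D → ℤˣ} {a : D}
    (h : ∀ b, g.SameCycle a b ↔ f.SameCycle a b) (huv : ∀ b, f.SameCycle a b → u b = v b) :
    cycleProd f u a = cycleProd g v a := by
  classical
  unfold cycleProd
  refine Finset.prod_congr ?_ fun b hb => huv b (by simpa [h] using hb)
  ext b
  simp [h]

theorem cycleProd_eq_of_sameCycle [Fintype D] {f : Perm D} (u : D → ℤˣ) {a b : D}
    (h : f.SameCycle a b) : cycleProd f u a = cycleProd f u b := by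
  classical
  unfold cycleProd
  refine Finset.prod_congr ?_ fun _ _ => rfl
  ext c
  simp only [Finset.mem_filter, Finset.mem_univ, true_and]
  exact ⟨h.symm.trans, h.trans⟩

theorem zpow_comp_apply {T : Type*} {f : Perm D} {g : Perm T} {i : T → D}
    (hfg : ∀ t, i (g t) = f (i t)) (k : ℤ) : ∀ t : T, i ((g ^ k) t) = (f ^ k) (i t) := by
  induction k with
  | zero => intro t; rfl
  | succ k ih =>
    intro t
    rw [zpow_add_one, zpow_add_one, Perm.mul_apply, Perm.mul_apply, ih, hfg]
  | pred k ih =>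
    intro t
    rw [zpow_sub_one, zpow_sub_one, Perm.mul_apply, Perm.mul_apply, ih]
    congr 1
    rw [eq_inv_iff_eq, ← hfg, ← Perm.mul_apply g, mul_inv_cancel, Perm.one_apply]

theorem sameCycle_comp_iff {T : Type*} {f : Perm D} {g : Perm T} {i : T → D}
    (hi : Function.Injective i) (hfg : ∀ t, i (g t) = f (i t)) {s t : T} :
    g.SameCycle s t ↔ f.SameCycle (i s) (i t) :=
  exists_congr fun k => by rw [← zpow_comp_apply hfg, hi.eq_iff]

/-- Used to restrict a map to one component, and to pass to those faces that alternate between two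
matchings in a fixed direction. -/
theorem cycleProd_comp [Fintype D] {T : Type*} [Fintype T] {f : Perm D} {g : Perm T} {i : T → D}
    (hi : Function.Injective i) (hfg : ∀ t, i (g t) = f (i t)) (u : D → ℤˣ) (t : T) :
    cycleProd g (u ∘ i) t = cycleProd f u (i t) := by
  classical
  unfold cycleProd
  refine Finset.prod_bij (fun s _ => i s) ?_ (fun _ _ _ _ h => hi h) ?_ (fun _ _ => rfl)
  · intro s hs
    obtain ⟨k, rfl⟩ := (Finset.mem_filter.1 hs).2
    exact Finset.mem_filter.2 ⟨Finset.mem_univ _, k, (zpow_comp_apply hfg k t).symm⟩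
  · intro b hb
    obtain ⟨k, rfl⟩ := (Finset.mem_filter.1 hb).2
    exact ⟨(g ^ k) t, Finset.mem_filter.2 ⟨Finset.mem_univ _, k, rfl⟩, zpow_comp_apply hfg k t⟩

/-- If all cycle products except possibly one are `-1`, the total product determines that one. -/
theorem prod_eq_cycleProd [Fintype D] (f : Perm D) (u : D → ℤˣ) (x : D)
    (h : ∀ a, ¬ f.SameCycle x a → cycleProd f u a = -1) :
    ∏ a, u a = (-1) ^ f.numCycles * (-cycleProd f u x) := by
  classical
  have : Fintype (Quotient (SameCycle.setoid f)) := Fintype.ofFinite _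
  have hfib := Finset.prod_fiberwise (Finset.univ : Finset D)
    (Quotient.mk (SameCycle.setoid f)) u
  rw [← hfib]
  have hq : ∀ a, ∏ b with Quotient.mk (SameCycle.setoid f) b = Quotient.mk _ a, u b =
      cycleProd f u a := by
    intro a
    unfold cycleProd
    refine Finset.prod_congr ?_ fun _ _ => rfl
    ext b
    simp only [Finset.mem_filter, Finset.mem_univ, true_and, Quotient.eq]
    exact ⟨fun h => SameCycle.symm h, fun h => SameCycle.symm h⟩
  have h1 : ∀ q : Quotient (SameCycle.setoid f),
      ∏ b with Quotient.mk (SameCycle.setoid f) b = q, u b =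
        (-1) * if q = Quotient.mk _ x then -cycleProd f u x else 1 := by
    intro q
    induction q using Quotient.inductionOn with | h a => ?_
    rw [hq]
    split_ifs with hax
    · rw [cycleProd_eq_of_sameCycle u (Quotient.exact hax : f.SameCycle a x)]
      simp
    · rw [h a fun e => hax (Quotient.sound e.symm)]
      simp
  rw [Finset.prod_congr rfl fun q _ => h1 q, Finset.prod_mul_distrib, Finset.prod_ite_eq']
  simp [numCycles, Setoid.numClasses, Nat.card_eq_fintype_card]

theorem prod_eq_neg_one_pow_numCycles [Fintype D] {f : Perm D} {u : D → ℤˣ}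
    (h : ∀ a, cycleProd f u a = -1) : ∏ a, u a = (-1) ^ f.numCycles := by
  rcases isEmpty_or_nonempty D with hD | ⟨⟨x⟩⟩
  · have : IsEmpty (Quotient (SameCycle.setoid f)) := Quotient.instIsEmpty
    simp [numCycles, Setoid.numClasses]
  · rw [prod_eq_cycleProd f u x fun a _ => h a, h x]
    simp

end CycleProd

/-! ### Euler's formula mod 2 and the last face of a component. -/

section Parity

theorem neg_one_pow_card_eq_one {α : Perm D} {s : Finset D} (h : ∀ a ∈ s, α a ∈ s)
    (hα : ∀ a, α (α a) = a) (hne : ∀ a, α a ≠ a) : (-1 : ℤˣ) ^ s.card = 1 := by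
  rw [← Finset.prod_const]
  exact Finset.prod_involution (fun a _ => α a) (by simp) (fun a _ _ => hne a) (by simpa using h)
    (fun a _ => hα a)

/-- Every cycle of `τ` contains exactly one element of `m`. -/
def IsTransversal (τ : Perm D) (m : Finset D) : Prop := ∀ a, ∃! b, b ∈ m ∧ τ.SameCycle a b

theorem IsTransversal.numCycles_eq {τ : Perm D} {m : Finset D} (h : IsTransversal τ m) :
    τ.numCycles = m.card := by
  rw [← Nat.card_eq_finsetCard m]
  refine (Nat.card_eq_of_bijective (fun b : m => Quotient.mk (SameCycle.setoid τ) b)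
    ⟨fun b c hbc => ?_, fun q => ?_⟩).symm
  · exact Subtype.ext ((h b).unique ⟨b.2, SameCycle.refl _ _⟩ ⟨c.2, Quotient.exact hbc⟩)
  · induction q using Quotient.inductionOn with | h a => ?_
    obtain ⟨b, ⟨hb, hab⟩, -⟩ := h a
    exact ⟨⟨b, hb⟩, Quotient.sound hab.symm⟩

variable [DecidableEq D]

/-- The signs `u`, changed at the elements of `m` whose partner under `α` is not in `m`. -/
def twist (α : Perm D) (m : Finset D) (u : D → ℤˣ) (a : D) : ℤˣ :=
  if a ∈ m ∧ α a ∉ m then -u a else u a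

variable [Fintype D]

theorem cycleProd_involution {α : Perm D} {u : D → ℤˣ} (hα : ∀ a, α (α a) = a)
    (hne : ∀ a, α a ≠ a) (hu : ∀ a, u (α a) = -u a) (a : D) : cycleProd α u a = -1 := by
  classical
  have : (Finset.univ.filter fun b => α.SameCycle a b) = {a, α a} := by
    ext b
    simp [sameCycle_involution_iff hα]
  unfold cycleProd
  convert Finset.prod_pair (f := u) (hne a).symm using 1
  · exact Finset.prod_congr (by convert this) fun _ _ => rfl
  · simp [hu]

/-- If all face products except possibly one are `-1`, so is that one. -/
theorem cycleProd_twist_eq_of_forall {τ α : Perm D} {u : D → ℤˣ} {m : Finset D}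
    (hα : ∀ a, α (α a) = a) (hne : ∀ a, α a ≠ a) (hu : ∀ a, u (α a) = -u a)
    (hm : IsTransversal τ m) (x : D)
    (h : ∀ a, ¬ (τ * α).SameCycle x a → cycleProd (τ * α) (twist α m u) a = -1) :
    cycleProd (τ * α) (twist α m u) x = -1 := by
  have hcard : (-1 : ℤˣ) ^ Fintype.card D = 1 :=
    neg_one_pow_card_eq_one (s := Finset.univ) (by simp) hα hne
  have h1 := prod_eq_cycleProd _ _ _ h
  have h2 : ∏ a, u a = (-1) ^ α.numCycles :=
    prod_eq_neg_one_pow_numCycles (cycleProd_involution hα hne hu)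
  have h3 : ∏ a, twist α m u a = (-1) ^ (m.filter fun a => α a ∉ m).card * ∏ a, u a := by
    have : ∀ a, twist α m u a = (if a ∈ m ∧ α a ∉ m then -1 else 1) * u a := by
      intro a; unfold twist; split_ifs <;> simp
    rw [Finset.prod_congr rfl fun a _ => this a, Finset.prod_mul_distrib, ← Finset.prod_filter,
      Finset.prod_const]
    congr 3
    ext a
    simp
  -- Darts of `m` with partner in `m` pair off, so the number of sign changes made by `twist` has
  -- the parity of `m.card`, the number of vertices.
  have h4 : (-1 : ℤˣ) ^ (m.filter fun a => ¬ α a ∉ m).card = 1 :=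
    neg_one_pow_card_eq_one (by simp +contextual [hα]) hα hne
  have h5 : (-1 : ℤˣ) ^ m.card = (-1) ^ (m.filter fun a => α a ∉ m).card := by
    rw [← Finset.card_filter_add_card_filter_not (fun a => α a ∉ m), pow_add, h4, mul_one]
  -- As the number of darts is even, this says that the number of faces is congruent mod 2 to
  -- vertices plus edges; planarity plays no role.
  have hs : sign (τ * α) = sign τ * sign α := sign_mul _ _
  simp only [sign_eq_neg_one_pow, pow_add, hcard, one_mul, hm.numCycles_eq, h5] at hs
  rw [h3, h2, hs] at h1
  have h6 := mul_left_cancel (h1.symm.trans (mul_one _).symm)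
  rw [← h6, neg_neg]

/-- A version of `cycleProd_twist_eq_of_forall` for the component of `x`. -/
theorem cycleProd_twist_eq_of_forall_orbit {τ α : Perm D} {u : D → ℤˣ} {m : Finset D}
    (hα : ∀ a, α (α a) = a) (hne : ∀ a, α a ≠ a) (hu : ∀ a, u (α a) = -u a)
    (hm : IsTransversal τ m) (x : D)
    (h : ∀ a, orbitSetoid τ α x a → ¬ (τ * α).SameCycle x a →
      cycleProd (τ * α) (twist α m u) a = -1) :
    cycleProd (τ * α) (twist α m u) x = -1 := by
  classical
  have hτP : ∀ a, orbitSetoid τ α x (τ a) ↔ orbitSetoid τ α x a := fun a =>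
    have h1 : orbitSetoid τ α a (τ a) :=
      (le_sup_left : _ ≤ orbitSetoid τ α) (sameCycleSetoid_le_iff.1 le_rfl a)
    ⟨fun h => Setoid.trans' _ h (Setoid.symm' _ h1), fun h => Setoid.trans' _ h h1⟩
  have hαP : ∀ a, orbitSetoid τ α x (α a) ↔ orbitSetoid τ α x a := fun a =>
    have h1 : orbitSetoid τ α a (α a) :=
      (le_sup_right : _ ≤ orbitSetoid τ α) (sameCycleSetoid_le_iff.1 le_rfl a)
    ⟨fun h => Setoid.trans' _ h (Setoid.symm' _ h1), fun h => Setoid.trans' _ h h1⟩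
  let τ' : Perm {a // orbitSetoid τ α x a} := τ.subtypePerm hτP
  let α' : Perm {a // orbitSetoid τ α x a} := α.subtypePerm hαP
  let m' : Finset {a // orbitSetoid τ α x a} := m.subtype _
  have hcomp : ∀ a : {a // orbitSetoid τ α x a},
      cycleProd (τ' * α') (twist α' m' fun a => u a) a =
        cycleProd (τ * α) (twist α m u) a := by
    intro a
    rw [← cycleProd_comp (g := τ' * α') Subtype.val_injective (fun _ => rfl)]
    congr 1
    ext b
    simp [twist, m', α']
  rw [← hcomp ⟨x, Setoid.refl' _ x⟩]
  refine cycleProd_twist_eq_of_forall (fun a => Subtype.ext (hα a))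
    (fun a e => hne a (congrArg Subtype.val e)) (fun a => hu a) ?_ _ ?_
  · intro a
    obtain ⟨b, ⟨hbm, hab⟩, hb⟩ := hm a
    have hP : orbitSetoid τ α x b :=
      Setoid.trans' _ a.2 ((le_sup_left : _ ≤ orbitSetoid τ α) hab)
    refine ⟨⟨b, hP⟩, ⟨by simpa [m'] using hbm, sameCycle_subtypePerm.2 hab⟩, ?_⟩
    rintro c ⟨hcm, hac⟩
    exact Subtype.ext (hb c ⟨by simpa [m'] using hcm, sameCycle_subtypePerm.1 hac⟩)
  · intro a ha
    rw [hcomp]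
    refine h a a.2 fun e => ha ?_
    exact (sameCycle_comp_iff (g := τ' * α') Subtype.val_injective fun _ => rfl).2 e

end Parity

end Equiv.Perm

/-! ### Reduction to the darts of two matchings. -/

namespace Equiv.Perm

section Reduction

variable {D : Type*} [DecidableEq D]

theorem IsTransversal.detach [Finite D] {τ : Perm D} {m : Finset D} (h : IsTransversal τ m)
    {x : D} (hx : x ∉ m) : IsTransversal (τ.detach x) (insert x m) := by
  have hfix := detach_apply_self τ x
  have hτx : τ x ≠ x := fun e => by
    obtain ⟨b, ⟨hb, hxb⟩, -⟩ := h x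
    rw [(sameCycle_of_apply_eq_self e).1 hxb] at hb
    exact hx hb
  have key : ∀ {a b}, a ≠ x → b ≠ x → ((τ.detach x).SameCycle a b ↔ τ.SameCycle a b) := by
    intro a b ha hb
    have hn : ∀ c, c ≠ x → ¬ (τ.detach x).SameCycle c x := fun c hc e =>
      hc ((sameCycle_of_apply_eq_self hfix).1 e.symm)
    have hiff := Setoid.ext_iff.1 (setoid_detach hτx) a b
    rw [SameCycle.setoid_apply, Setoid.merge_apply] at hiff
    rw [hiff]
    refine ⟨Or.inl, fun e => e.elim id ?_⟩
    rintro ⟨h1 | h1, h2 | h2⟩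
    · exact absurd h1 (hn a ha)
    · exact absurd h1 (hn a ha)
    · exact absurd h2 (hn b hb)
    · exact SameCycle.trans h1 (SameCycle.symm h2)
  intro a
  by_cases ha : a = x
  · subst ha
    refine ⟨a, ⟨Finset.mem_insert_self _ _, SameCycle.refl _ _⟩, ?_⟩
    rintro c ⟨-, hc⟩
    exact (sameCycle_of_apply_eq_self hfix).1 hc
  · obtain ⟨b, ⟨hb, hab⟩, hu⟩ := h a
    have hbx : b ≠ x := fun e => hx (e ▸ hb)
    refine ⟨b, ⟨Finset.mem_insert_of_mem hb, (key ha hbx).2 hab⟩, ?_⟩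
    rintro c ⟨hc, hac⟩
    have hcx : c ≠ x := by
      rintro rfl
      exact ha ((sameCycle_of_apply_eq_self hfix).1 hac.symm)
    exact hu c ⟨Finset.mem_of_mem_insert_of_ne hc hcx, (key ha hcx).1 hac⟩

/-- If `τ x` is also in `m`, it is the only element of `m` on its cycle, so `x` is a fixed point and
`m'` must contain it too. -/
theorem IsTransversal.apply_mem {τ : Perm D} {m m' : Finset D} (h : IsTransversal τ m)
    (h' : IsTransversal τ m') (hall : ∀ a, a ∈ m ∨ a ∈ m') {x : D} (hx : x ∈ m) : τ x ∈ m' := by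
  by_cases hτ : τ x ∈ m
  · have hfix : τ x = x := (h x).unique ⟨hτ, 1, by simp⟩ ⟨hx, SameCycle.refl _ _⟩
    obtain ⟨b, ⟨hb, hxb⟩, -⟩ := h' x
    rw [(sameCycle_of_apply_eq_self hfix).1 hxb] at hb
    rwa [hfix]
  · exact (hall _).resolve_left hτ

variable [Fintype D]

theorem cycleProd_twist_detach {τ α : Perm D} {u : D → ℤˣ} {m : Finset D} (hpl : IsPlanar τ α)
    (hα : ∀ a, α (α a) = a) (hne : ∀ a, α a ≠ a) (hu : ∀ a, u (α a) = -u a)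
    (hm : IsTransversal τ m) (hK : ∀ a, cycleProd (τ * α) (twist α m u) a = -1)
    {x : D} (hx : x ∉ m) (hτx : τ x ≠ x) (a : D) :
    cycleProd (τ.detach x * α) (twist α (insert x m) u) a = -1 := by
  have hm' := hm.detach hx
  obtain ⟨-, hsep⟩ := hpl.detach hα hτx
  -- faces through neither `x` nor `τ x` are unchanged
  have hold : ∀ a, ¬ (τ.detach x * α).SameCycle a x → ¬ (τ.detach x * α).SameCycle a (τ x) →
      cycleProd (τ.detach x * α) (twist α (insert x m) u) a = -1 := by
    intro a h1 h2
    rw [← hK a]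
    -- Inserting `x` into `m` can change `twist` only at `x` and `α x`. The face walk goes from `α
    -- x` to `x`, so a face avoiding `x` avoids both.
    have hαx : (τ.detach x * α).SameCycle (α x) x :=
      ⟨1, by simp [hα, detach_apply_self]⟩
    refine cycleProd_congr (fun b => ?_) fun b hb => ?_
    · rw [detach_mul] at h1 h2 ⊢
      exact (sameCycle_swap_mul_iff h1 h2).symm
    · have hbx : b ≠ x := fun e => h1 (e ▸ hb)
      have hbαx : α b ≠ x := fun e => h1 (by
        have hb' : b = α x := by rw [← e, hα]
        exact (hb' ▸ hb).trans hαx)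
      simp [twist, hbx, hbαx]
  have hcomp : ∀ {c d}, (τ.detach x * α).SameCycle c d → orbitSetoid (τ.detach x) α c d :=
    fun h => setoid_mul_le_orbitSetoid _ _ h
  -- If the component of `a` contains both `x` and `τ x`, they lie on the same face by `hsep`. So it
  -- has no other altered face than that of `a`.
  by_cases hax : (τ.detach x * α).SameCycle a x ∨ (τ.detach x * α).SameCycle a (τ x)
  · refine cycleProd_twist_eq_of_forall_orbit hα hne hu hm' a fun b hab hb => ?_
    refine hold b (fun h => ?_) fun h => ?_
    · rcases hax with h' | h'
      · exact hb (h'.trans h.symm)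
      · exact hb (h'.trans ((hsep (Setoid.trans' _ (Setoid.symm' _ (hcomp h))
          (Setoid.trans' _ (Setoid.symm' _ hab) (hcomp h')))).symm.trans h.symm))
    · rcases hax with h' | h'
      · exact hb (h'.trans ((hsep (Setoid.trans' _ (Setoid.symm' _ (hcomp h'))
          (Setoid.trans' _ hab (hcomp h)))).trans h.symm))
      · exact hb (h'.trans h.symm)
  · exact hold a (fun h => hax (Or.inl h)) fun h => hax (Or.inr h)

/-- Induction on the number of darts outside `m ∪ m'`. A detached dart joins both sets, so `m' \ m`
never changes; once the two sets cover all darts, its complement is the current `m`. This expresses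
the final twist through the original sets. -/
theorem exists_reduction_of_twist {τ α : Perm D} {u : D → ℤˣ} {m m' : Finset D}
    (hα : ∀ a, α (α a) = a) (hne : ∀ a, α a ≠ a) (hu : ∀ a, u (α a) = -u a)
    (hpl : IsPlanar τ α) (hm : IsTransversal τ m) (hm' : IsTransversal τ m')
    (hK : ∀ a, cycleProd (τ * α) (twist α m u) a = -1) :
    ∃ τ₁ : Perm D, SameCycle.setoid τ₁ ≤ SameCycle.setoid τ ∧
      (∀ a ∈ m, τ₁ a ∈ m') ∧ (∀ a ∈ m', τ₁ a ∈ m) ∧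
      ∀ a, cycleProd (τ₁ * α) (twist α (m' \ m)ᶜ u) a = -1 := by
  induction hn : ((m ∪ m')ᶜ).card using Nat.strong_induction_on generalizing τ m m' with
  | _ n ih =>
    by_cases hall : ∀ a, a ∈ m ∨ a ∈ m'
    · refine ⟨τ, le_rfl, fun a ha => hm.apply_mem hm' hall ha,
        fun a ha => hm'.apply_mem hm (fun a => (hall a).symm) ha, ?_⟩
      have : (m' \ m)ᶜ = m := by
        ext a
        have := hall a
        simp only [Finset.mem_compl, Finset.mem_sdiff]
        tauto
      rwa [this]
    · push Not at hall
      obtain ⟨x, hx, hx'⟩ := hall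
      have hτx : τ x ≠ x := fun e => by
        obtain ⟨b, ⟨hb, hxb⟩, -⟩ := hm x
        exact hx ((sameCycle_of_apply_eq_self e).1 hxb ▸ hb)
      obtain ⟨τ₁, h1, h2, h3, h4⟩ := ih ((insert x m ∪ insert x m')ᶜ).card
        (hn ▸ Finset.card_lt_card (by
          refine Finset.ssubset_iff_of_subset (fun a => ?_) |>.2 ⟨x, ?_, ?_⟩
          · simp only [Finset.mem_compl, Finset.mem_union, Finset.mem_insert]
            tauto
          · simp [hx, hx']
          · simp))
        (hpl.detach hα hτx).1 (hm.detach hx) (hm'.detach hx')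
        (cycleProd_twist_detach hpl hα hne hu hm hK hx hτx) rfl
      have hne' : ∀ a, a ≠ x → τ₁ a ≠ x := fun a ha e => ha <| by
        have h : (τ.detach x).SameCycle a x := h1 ⟨1, by simpa using e⟩
        exact (sameCycle_of_apply_eq_self (detach_apply_self τ x)).1 h.symm
      have hmem : ∀ {s t : Finset D}, x ∉ s → (∀ a ∈ insert x s, τ₁ a ∈ insert x t) →
          ∀ a ∈ s, τ₁ a ∈ t := fun hs h a ha =>
        Finset.mem_of_mem_insert_of_ne (h a (Finset.mem_insert_of_mem ha))
          (hne' a fun e => hs (e ▸ ha))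
      refine ⟨τ₁, h1.trans ?_, hmem hx h2, hmem hx' h3, ?_⟩
      · rw [setoid_detach hτx]
        exact Setoid.le_merge _ _ _
      · have : insert x m' \ insert x m = m' \ m := by
          ext a
          simp only [Finset.mem_sdiff, Finset.mem_insert]
          constructor
          · tauto
          · rintro ⟨h, h'⟩
            refine ⟨Or.inr h, ?_⟩
            rintro (rfl | e)
            exacts [hx' h, h' e]
        rwa [this] at h4

/-- All darts outside two perfect matchings of a planar map can be detached such that the product
along every face remains `-1`. -/
theorem exists_reduction {τ α : Perm D} {u : D → ℤˣ} {m m' : Finset D}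
    (hα : ∀ a, α (α a) = a) (hne : ∀ a, α a ≠ a) (hu : ∀ a, u (α a) = -u a)
    (hpl : IsPlanar τ α) (hm : IsTransversal τ m) (hm' : IsTransversal τ m')
    (hmα : ∀ a, α a ∈ m ↔ a ∈ m) (hmα' : ∀ a, α a ∈ m' ↔ a ∈ m')
    (hK : ∀ a, cycleProd (τ * α) u a = -1) :
    ∃ τ₁ : Perm D, SameCycle.setoid τ₁ ≤ SameCycle.setoid τ ∧
      (∀ a ∈ m, τ₁ a ∈ m') ∧ (∀ a ∈ m', τ₁ a ∈ m) ∧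
      ∀ a, cycleProd (τ₁ * α) u a = -1 := by
  have htw : ∀ {s : Finset D}, (∀ a, α a ∈ s ↔ a ∈ s) → twist α s u = u := fun hs => by
    ext1 a
    simp [twist, hs]
  have h := exists_reduction_of_twist hα hne hu hpl hm hm' (by rwa [htw hmα])
  rwa [htw (by simp [hmα, hmα'])] at h

end Reduction

/-- `ρ` is the exchange of the two summands, a product of `n` transpositions, followed by `σ'⁻¹` and
`σ` on the summands. -/
theorem sign_of_inl_inr {n : ℕ} {ρ : Perm (Fin n ⊕ Fin n)} {σ σ' : Perm (Fin n)}
    (hl : ∀ i, ρ (Sum.inl i) = Sum.inr (σ i)) (hr : ∀ i, ρ (Sum.inr (σ' i)) = Sum.inl i) :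
    sign ρ = (-1) ^ n * (sign σ * sign σ') := by
  have h1 : ∀ j, ρ (Sum.inr j) = Sum.inl (σ'⁻¹ j) := fun j => by
    rw [← hr]
    simp
  let s : Perm (Fin n ⊕ Fin n) := Equiv.sumComm (Fin n) (Fin n)
  have hs : sign s = (-1) ^ n := by
    -- With `1` on the left and `-1` on the right, each 2-cycle of `s` has product `-1`.
    have hc := prod_eq_neg_one_pow_numCycles (f := s)
      (u := fun a => Sum.elim (fun _ => (1 : ℤˣ)) (fun _ => -1) a)
      (cycleProd_involution (by rintro (a | a) <;> rfl)
        (by rintro (a | a) <;> simp [s]) (by rintro (a | a) <;> simp [s]))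
    rw [sign_eq_neg_one_pow, pow_add, ← hc]
    simp [← two_mul]
  have hρ : ρ = sumCongr σ'⁻¹ σ * s := by
    ext1 (a | a)
    · simp [hl, s]
    · simp [h1, s]
  rw [hρ, sign_mul, hs, sign_sumCongr, sign_inv]
  simp [mul_comm]

end Equiv.Perm

/-! ### From the plane graph to its combinatorial map. -/

namespace BipartiteGraph

variable {B W E : Type*} {G : BipartiteGraph B W E}

theorem reversal_apply (e : E) (b : Bool) : reversal E (e, b) = (e, !b) := rfl

theorem reversal_reversal (d : E × Bool) : reversal E (reversal E d) = d := by
  obtain ⟨e, b⟩ := d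
  simp [reversal_apply]

theorem reversal_ne (d : E × Bool) : reversal E d ≠ d := by
  obtain ⟨e, b⟩ := d
  simp [reversal_apply]

theorem snd_eq_of_origin_eq {d d' : E × Bool} (h : G.origin d = G.origin d') : d.2 = d'.2 := by
  obtain ⟨e, _ | _⟩ := d <;> obtain ⟨e', _ | _⟩ := d' <;> simp_all [origin]

/-- The signs of the darts that turn the Kasteleyn condition into the condition that the product
along every face is `-1`. -/
def dartSign (κ : E → ℤˣ) (d : E × Bool) : ℤˣ := if d.2 then κ d.1 else -κ d.1

theorem dartSign_reversal (κ : E → ℤˣ) (d : E × Bool) :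
    dartSign κ (reversal E d) = -dartSign κ d := by
  obtain ⟨e, _ | _⟩ := d <;> simp [reversal_apply, dartSign]

theorem toSimpleGraph_adj_reversal (d : E × Bool) :
    G.toSimpleGraph.Adj (G.origin d) (G.origin (reversal E d)) := by
  obtain ⟨e, _ | _⟩ := d <;>
    simp only [reversal_apply, toSimpleGraph, SimpleGraph.fromRel_adj, origin, ne_eq, reduceCtorEq,
      not_false_eq_true, Bool.not_false, Bool.not_true, true_and]
  · exact Or.inl ⟨e, rfl, rfl⟩
  · exact Or.inr ⟨e, rfl, rfl⟩

theorem exists_of_adj {u v : B ⊕ W} (h : G.toSimpleGraph.Adj u v) :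
    ∃ d, G.origin d = u ∧ G.origin (reversal E d) = v := by
  rcases (SimpleGraph.fromRel_adj _ _ _).1 h with ⟨-, ⟨e, rfl, rfl⟩ | ⟨e, rfl, rfl⟩⟩
  · exact ⟨(e, false), rfl, rfl⟩
  · exact ⟨(e, true), rfl, rfl⟩

namespace RotationSystem

open Equiv.Perm

variable (R : G.RotationSystem)

theorem origin_next (d : E × Bool) : G.origin (R.next d) = G.origin d :=
  ((R.sameCycle_iff d (R.next d)).1 ⟨1, by simp⟩).symm

theorem snd_facePerm (d : E × Bool) : (R.facePerm d).2 = !d.2 :=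
  snd_eq_of_origin_eq (R.origin_next (reversal E d))

/-- The connected component in which a dart lies. -/
def component (G : BipartiteGraph B W E) (d : E × Bool) : G.toSimpleGraph.ConnectedComponent :=
  G.toSimpleGraph.connectedComponentMk (G.origin d)

theorem exists_dart_of_walk {u v : B ⊕ W} (p : G.toSimpleGraph.Walk u v) :
    ∀ d, G.origin d = u → ∃ d', G.origin d' = v ∧ orbitSetoid R.next (reversal E) d d' := by
  induction p with
  | nil => exact fun d hd => ⟨d, hd, Setoid.refl' _ d⟩
  | cons h p ih =>
    intro d hd
    obtain ⟨c, rfl, hc⟩ := exists_of_adj h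
    obtain ⟨d', hd', hcd'⟩ := ih _ hc
    refine ⟨d', hd', Setoid.trans' _ (y := c) ?_ (Setoid.trans' _ ?_ hcd')⟩
    · exact (le_sup_left : _ ≤ orbitSetoid _ _) ((R.sameCycle_iff d c).2 hd)
    · exact (le_sup_right : _ ≤ orbitSetoid _ _) (sameCycleSetoid_le_iff.1 le_rfl c)

theorem component_eq_iff {d d' : E × Bool} :
    component G d = component G d' ↔ orbitSetoid R.next (reversal E) d d' := by
  constructor
  · intro h
    obtain ⟨p⟩ := SimpleGraph.ConnectedComponent.exact h
    obtain ⟨c, hc, hdc⟩ := R.exists_dart_of_walk p d rfl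
    exact Setoid.trans' _ hdc ((le_sup_left : _ ≤ orbitSetoid _ _) ((R.sameCycle_iff c d').2 hc))
  · intro h
    have : orbitSetoid R.next (reversal E) ≤ Setoid.ker (component G) := by
      refine sup_le (sameCycleSetoid_le_iff.2 fun a => ?_) (sameCycleSetoid_le_iff.2 fun a => ?_)
      · exact congrArg G.toSimpleGraph.connectedComponentMk (R.origin_next a).symm
      · exact SimpleGraph.ConnectedComponent.sound (toSimpleGraph_adj_reversal a).reachable
    exact this h

/-- Euler's formulas are summed over the components containing darts; isolated vertices carry none
and appear on neither side. -/
theorem IsPlane.isPlanar [Finite E] {R : G.RotationSystem} (hR : R.IsPlane) :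
    IsPlanar R.next (reversal E) := by
  set o := orbitSetoid R.next (reversal E) with ho
  have := Fintype.ofFinite (Quotient o)
  have hτ : SameCycle.setoid R.next ≤ o := le_sup_left
  have hα : SameCycle.setoid (reversal E) ≤ o := le_sup_right
  have hφ : SameCycle.setoid (R.next * reversal E) ≤ o := setoid_mul_le_orbitSetoid _ _
  have hone : o.numClasses = ∑ _q : Quotient o, 1 := by
    simp [Setoid.numClasses, Nat.card_eq_fintype_card]
  rw [IsPlanar, numCycles, numCycles, numCycles, ← ho, Setoid.numClasses_eq_sum hτ,
    Setoid.numClasses_eq_sum hα, Setoid.numClasses_eq_sum hφ, hone, Finset.mul_sum,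
    ← Finset.sum_add_distrib, ← Finset.sum_add_distrib]
  refine Finset.sum_congr rfl fun q _ => ?_
  rw [mul_one]
  induction q using Quotient.inductionOn with | h d => ?_
  have hcomp : ∀ {c}, component G c = component G d ↔ o c d := R.component_eq_iff
  have hE := hR (component G d) ⟨d.1, by
    refine hcomp (c := (d.1, false)) |>.2 ?_
    obtain ⟨e, _ | _⟩ := d
    · exact Setoid.refl' _ _
    · exact hα (sameCycleSetoid_le_iff.1 le_rfl (e, false))⟩
  convert hE using 2
  · refine Nat.card_eq_of_bijective (fun p => ⟨Quotient.lift G.origin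
      (fun a b hab => (R.sameCycle_iff a b).1 (SameCycle.setoid_apply.1 hab)) p.1, ?_⟩) ⟨?_, ?_⟩
    · obtain ⟨p, hp⟩ := p
      induction p using Quotient.inductionOn with | h a => ?_
      exact hcomp.2 (Quotient.exact hp)
    · rintro ⟨p, hp⟩ ⟨q, hq⟩ hpq
      induction p using Quotient.inductionOn with | h a => ?_
      induction q using Quotient.inductionOn with | h b => ?_
      exact Subtype.ext (Quotient.sound ((R.sameCycle_iff a b).2 (congrArg Subtype.val hpq)))
    · rintro ⟨v, hv⟩
      obtain ⟨p⟩ := SimpleGraph.ConnectedComponent.exact hv.symm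
      obtain ⟨c, rfl, hc⟩ := R.exists_dart_of_walk p d rfl
      exact ⟨⟨Quotient.mk _ c, Quotient.sound (Setoid.symm' _ hc)⟩, rfl⟩
  · refine Nat.card_congr (Equiv.subtypeEquivRight fun p => ?_)
    induction p using Quotient.inductionOn with | h a => ?_
    constructor
    · exact fun h => ⟨a, rfl, hcomp.2 (Quotient.exact h)⟩
    · rintro ⟨b, hb, hbd⟩
      have hab : SameCycle.setoid (R.next * reversal E) b a := Quotient.exact hb
      exact Quotient.sound (Setoid.trans' _ (Setoid.symm' _ (hφ hab)) (hcomp.1 hbd))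
  · refine (Nat.card_eq_of_bijective
      (fun e : {e // component G (e, false) = component G d} =>
        (⟨Quotient.mk _ (e.1, false), Quotient.sound (hcomp.1 e.2)⟩ :
          {p : Quotient (SameCycle.setoid (reversal E)) //
            Quotient.map' id (fun _ _ e => hα e) p = Quotient.mk o d})) ⟨?_, ?_⟩).symm
    · rintro ⟨e, he⟩ ⟨e', he'⟩ h
      have := (sameCycle_involution_iff reversal_reversal).1
        (Quotient.exact (congrArg Subtype.val h))
      simp only [reversal_apply, Prod.mk.injEq] at this
      exact Subtype.ext (by rcases this with h | h <;> exact h.1.symm)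
    · rintro ⟨p, hp⟩
      induction p using Quotient.inductionOn with | h a => ?_
      have ha : SameCycle.setoid (reversal E) (a.1, false) a := by
        obtain ⟨e, _ | _⟩ := a
        · exact Setoid.refl' _ _
        · exact sameCycleSetoid_le_iff.1 le_rfl (e, false)
      exact ⟨⟨a.1, hcomp.2 (Setoid.trans' _ (hα ha) (Quotient.exact hp))⟩,
        Subtype.ext (Quotient.sound ha)⟩

/-- A facial walk alternates between the colours, so a face of length `2k` has `k` darts leaving
`B`. Their extra signs contribute `(-1)^k`, which is what the distinction mod 4 compensates. -/
theorem IsKasteleyn.cycleProd_eq [Fintype E] {R : G.RotationSystem} {κ : E → ℤˣ}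
    (hκ : R.IsKasteleyn κ) (a : E × Bool) : cycleProd R.facePerm (dartSign κ) a = -1 := by
  classical
  set S : Finset (E × Bool) := Finset.univ.filter fun b => R.facePerm.SameCycle a b with hS
  have hface : ∀ d, R.faceOf d = R.faceOf a ↔ d ∈ S := fun d => by
    rw [hS, Finset.mem_filter]
    exact ⟨fun h => ⟨Finset.mem_univ _, SameCycle.symm (Quotient.exact h)⟩,
      fun h => Quotient.sound (SameCycle.symm h.2)⟩
  have hlen : R.faceLength (R.faceOf a) = S.card := by
    simp only [faceLength, hface, Nat.card_eq_fintype_card, Fintype.card_coe]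
  have hneg : R.negatives κ (R.faceOf a) = (S.filter fun d => κ d.1 = -1).card := by
    simp only [negatives, hface, Nat.card_eq_fintype_card, Fintype.card_subtype]
    congr 1
    ext d
    simp
  have hmap : ∀ d, R.facePerm d ∈ S ↔ d ∈ S := fun d => by simp [hS, sameCycle_apply_right]
  have hhalf : (S.filter fun d => ¬ d.2 = false).card = (S.filter fun d => d.2 = false).card := by
    refine Finset.card_equiv R.facePerm fun d => ?_
    simp [hmap, snd_facePerm]
  have hcard := Finset.card_filter_add_card_filter_not (s := S) fun d => d.2 = false
  have hprod : cycleProd R.facePerm (dartSign κ) a =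
      (-1) ^ (S.filter fun d => d.2 = false).card * (-1) ^ (S.filter fun d => κ d.1 = -1).card := by
    rw [← Finset.prod_const, ← Finset.prod_const, Finset.prod_filter (s := S),
      Finset.prod_filter (s := S), ← Finset.prod_mul_distrib]
    unfold cycleProd
    refine Finset.prod_congr (by ext; simp [hS]) fun d _ => ?_
    rcases Int.units_eq_one_or (κ d.1) with h | h <;> cases hd : d.2 <;> simp [dartSign, h, hd]
  obtain ⟨h0, h2⟩ := hκ (R.faceOf a)
  rw [hlen, hneg] at h0 h2
  rw [hprod]
  rcases Nat.even_or_odd (S.filter fun d => d.2 = false).card with he | ho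
  · rw [he.neg_one_pow, (h0 (by obtain ⟨k, hk⟩ := he; omega)).neg_one_pow]
    rfl
  · rw [ho.neg_one_pow, (h2 (by obtain ⟨k, hk⟩ := ho; omega)).neg_one_pow]
    rfl

end RotationSystem

end BipartiteGraph

/-! ### Matchings, their signs and the determinant. -/

namespace BipartiteGraph

open Equiv.Perm

variable {B W E : Type*} {G : BipartiteGraph B W E} {n : ℕ} {β : Fin n ≃ B} {ω : Fin n ≃ W}

/-- A choice of an edge joining `β i` to `ω (σ i)` for every `i`. -/
def IsEdgeChoice (G : BipartiteGraph B W E) (β : Fin n ≃ B) (ω : Fin n ≃ W)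
    (σ : Equiv.Perm (Fin n)) (p : Fin n → E) : Prop :=
  ∀ i, G.black (p i) = β i ∧ G.white (p i) = ω (σ i)

theorem IsEdgeChoice.injective {σ : Equiv.Perm (Fin n)} {p : Fin n → E}
    (h : G.IsEdgeChoice β ω σ p) : Function.Injective p := fun i j hij =>
  β.injective (by rw [← (h i).1, hij, (h j).1])

theorem IsEdgeChoice.isPerfectMatching [DecidableEq E] {σ : Equiv.Perm (Fin n)} {p : Fin n → E}
    (h : G.IsEdgeChoice β ω σ p) : G.IsPerfectMatching (Finset.univ.image p) := by
  refine ⟨fun b => ⟨p (β.symm b), ⟨by simp, by simp [(h _).1]⟩, ?_⟩,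
    fun w => ⟨p (σ.symm (ω.symm w)), ⟨by simp, by simp [(h _).2]⟩, ?_⟩⟩
  · rintro e ⟨he, rfl⟩
    obtain ⟨i, -, rfl⟩ := Finset.mem_image.1 he
    simp [(h i).1]
  · rintro e ⟨he, rfl⟩
    obtain ⟨i, -, rfl⟩ := Finset.mem_image.1 he
    simp [(h i).2]

theorem IsEdgeChoice.matchesVia [DecidableEq E] {σ : Equiv.Perm (Fin n)} {p : Fin n → E}
    (h : G.IsEdgeChoice β ω σ p) : G.MatchesVia β ω σ (Finset.univ.image p) := by
  intro e he
  obtain ⟨i, -, rfl⟩ := Finset.mem_image.1 he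
  exact ⟨i, h i⟩

theorem IsPerfectMatching.exists_edgeChoice [DecidableEq E] {μ : Finset E}
    (hμ : G.IsPerfectMatching μ) {σ : Equiv.Perm (Fin n)} (hσ : G.MatchesVia β ω σ μ) :
    ∃ p, G.IsEdgeChoice β ω σ p ∧ Finset.univ.image p = μ := by
  choose p hp _ using fun i => hμ.1 (β i)
  refine ⟨p, fun i => ⟨(hp i).2, ?_⟩, ?_⟩
  · obtain ⟨j, hj, hj'⟩ := hσ _ (hp i).1
    rw [hj', β.injective ((hp i).2.symm.trans hj)]
  · ext e
    simp only [Finset.mem_image, Finset.mem_univ, true_and]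
    constructor
    · rintro ⟨i, rfl⟩
      exact (hp i).1
    · intro he
      refine ⟨β.symm (G.black e), (hμ.1 (G.black e)).unique ⟨(hp _).1, ?_⟩ ⟨he, rfl⟩⟩
      rw [(hp _).2, Equiv.apply_symm_apply]

theorem IsPerfectMatching.existsUnique_matchesVia {μ : Finset E} (hμ : G.IsPerfectMatching μ)
    (β : Fin n ≃ B) (ω : Fin n ≃ W) : ∃! σ : Equiv.Perm (Fin n), G.MatchesVia β ω σ μ := by
  choose p hp hpu using fun i => hμ.1 (β i)
  have hinj : Function.Injective fun i => ω.symm (G.white (p i)) := by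
    intro i j hij
    have h := (hμ.2 (G.white (p i))).unique ⟨(hp i).1, rfl⟩
      ⟨(hp j).1, (ω.symm.injective hij).symm⟩
    exact β.injective (by rw [← (hp i).2, h, (hp j).2])
  refine ⟨Equiv.ofBijective _ (Finite.injective_iff_bijective.1 hinj), fun e he => ?_, ?_⟩
  · refine ⟨β.symm (G.black e), by simp, ?_⟩
    have : e = p (β.symm (G.black e)) := hpu _ e ⟨he, by simp⟩
    simp [← this]
  · intro τ hτ
    ext1 i
    obtain ⟨j, hj, hj'⟩ := hτ _ (hp i).1
    obtain rfl := β.injective ((hp i).2.symm.trans hj)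
    simp [hj']

theorem isTransversal_product [Fintype E] [DecidableEq E] (R : G.RotationSystem) {μ : Finset E}
    (hμ : G.IsPerfectMatching μ) :
    IsTransversal R.next (μ ×ˢ (Finset.univ : Finset Bool)) := by
  rintro ⟨e, _ | _⟩
  · obtain ⟨e', ⟨he', h⟩, hu⟩ := hμ.1 (G.black e)
    refine ⟨(e', false), ⟨by simpa, (R.sameCycle_iff _ _).2 (congrArg Sum.inl h.symm)⟩, ?_⟩
    rintro ⟨c, _ | _⟩ ⟨hc, hec⟩
    · have := Sum.inl_injective ((R.sameCycle_iff _ _).1 hec)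
      rw [hu c ⟨by simpa using hc, this.symm⟩]
    · exact absurd ((R.sameCycle_iff _ _).1 hec) (by simp [origin])
  · obtain ⟨e', ⟨he', h⟩, hu⟩ := hμ.2 (G.white e)
    refine ⟨(e', true), ⟨by simpa, (R.sameCycle_iff _ _).2 (congrArg Sum.inr h.symm)⟩, ?_⟩
    rintro ⟨c, _ | _⟩ ⟨hc, hec⟩
    · exact absurd ((R.sameCycle_iff _ _).1 hec) (by simp [origin])
    · have := Sum.inr_injective ((R.sameCycle_iff _ _).1 hec)
      rw [hu c ⟨by simpa using hc, this.symm⟩]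

theorem sign_mul_prod_eq [Fintype E] {R : G.RotationSystem} (hR : R.IsPlane) {κ : E → ℤˣ}
    (hκ : R.IsKasteleyn κ) {σ σ' : Equiv.Perm (Fin n)} {p p' : Fin n → E}
    (hp : G.IsEdgeChoice β ω σ p) (hp' : G.IsEdgeChoice β ω σ' p') :
    sign σ * ∏ i, κ (p i) = sign σ' * ∏ i, κ (p' i) := by
  classical
  have hmem : ∀ (s : Finset E) (a : E × Bool),
      reversal E a ∈ s ×ˢ (Finset.univ : Finset Bool) ↔ a ∈ s ×ˢ Finset.univ := fun s a => by
    obtain ⟨e, b⟩ := a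
    simp [reversal_apply]
  have hμ := hp.isPerfectMatching
  have hμ' := hp'.isPerfectMatching
  obtain ⟨τ₁, hτ, h1, h2, hK⟩ := exists_reduction reversal_reversal reversal_ne
    (dartSign_reversal κ) hR.isPlanar (isTransversal_product R hμ) (isTransversal_product R hμ')
    (hmem _) (hmem _) hκ.cycleProd_eq
  have horig : ∀ a, G.origin (τ₁ a) = G.origin a := fun a =>
    ((R.sameCycle_iff _ _).1 (hτ (sameCycleSetoid_le_iff.1 le_rfl a))).symm
  -- Only one of the two directions is kept: edges of `μ` leave `B`, edges of `μ'` leave `W`. An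
  -- edge in both matchings thus gives two darts.
  let ι : Fin n ⊕ Fin n → E × Bool :=
    Sum.elim (fun i => (p i, false)) fun j => (p' (σ'⁻¹ j), true)
  let ρ : Equiv.Perm (Fin n ⊕ Fin n) := (Equiv.sumCongr σ σ'⁻¹).trans (Equiv.sumComm _ _)
  have hι : Function.Injective ι := by
    rintro (i | i) (j | j) hij
    · simp only [ι, Sum.elim_inl, Prod.mk.injEq, and_true] at hij
      rw [hp.injective hij]
    · simp [ι] at hij
    · simp [ι] at hij
    · simp only [ι, Sum.elim_inr, Prod.mk.injEq, and_true] at hij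
      rw [σ'⁻¹.injective (hp'.injective hij)]
  -- `τ₁` preserves the vertex and exchanges the two matchings, and each vertex has only one edge in
  -- each matching; this determines the image dart.
  have hρ : ∀ t, ι (ρ t) = (τ₁ * reversal E) (ι t) := by
    rintro (i | j)
    · have hm := h1 (p i, true) (by simp)
      have ho := horig (p i, true)
      change (p' (σ'⁻¹ (σ i)), true) = τ₁ (p i, true)
      have hb : true = (τ₁ (p i, true)).2 := (snd_eq_of_origin_eq ho).symm
      generalize τ₁ (p i, true) = d at hm ho hb ⊢
      obtain ⟨e, b⟩ := d
      obtain rfl : true = b := hb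
      congr 1
      refine (hμ'.2 (ω (σ i))).unique ⟨by simp, by simp [(hp' _).2]⟩ ⟨by simpa using hm, ?_⟩
      rw [← (hp i).2]
      exact Sum.inr_injective ho
    · have hm := h2 (p' (σ'⁻¹ j), false) (by simp)
      have ho := horig (p' (σ'⁻¹ j), false)
      change (p (σ'⁻¹ j), false) = τ₁ (p' (σ'⁻¹ j), false)
      have hb : false = (τ₁ (p' (σ'⁻¹ j), false)).2 := (snd_eq_of_origin_eq ho).symm
      generalize τ₁ (p' (σ'⁻¹ j), false) = d at hm ho hb ⊢
      obtain ⟨e, b⟩ := d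
      obtain rfl : false = b := hb
      congr 1
      refine (hμ.1 (β (σ'⁻¹ j))).unique ⟨by simp, (hp _).1⟩ ⟨by simpa using hm, ?_⟩
      rw [← (hp' _).1]
      exact Sum.inl_injective ho
  have hprod := prod_eq_neg_one_pow_numCycles (f := ρ) (u := dartSign κ ∘ ι) fun t => by
    rw [cycleProd_comp hι hρ]
    exact hK _
  have hsign := sign_of_inl_inr (ρ := ρ) (σ := σ) (σ' := σ') (fun i => rfl)
    fun i => by simp [ρ]
  have hneg : ∏ i, -κ (p i) = (-1) ^ n * ∏ i, κ (p i) := by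
    rw [Finset.prod_neg]
    simp
  have hre : ∏ j, κ (p' (σ'⁻¹ j)) = ∏ i, κ (p' i) :=
    Equiv.prod_comp σ'⁻¹ fun i => κ (p' i)
  -- On `2n` points the sign is `(-1)` to the number of cycles, which is the total product of dart
  -- signs; the factors `(-1)^n` on both sides then cancel.
  rw [sign_eq_neg_one_pow, pow_add, ← hprod, Fintype.prod_sum_type] at hsign
  simp only [Function.comp_apply, ι, Sum.elim_inl, Sum.elim_inr, dartSign, Fintype.card_sum,
    Fintype.card_fin, ← two_mul, pow_mul, neg_one_sq, one_pow, one_mul, if_true, if_false,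
    Bool.false_eq_true, hneg, hre, mul_assoc] at hsign
  have h := mul_left_cancel hsign
  generalize ∏ i, κ (p i) = a at h
  generalize ∏ i, κ (p' i) = a' at h
  rw [← mul_left_inj a', mul_assoc, h, ← mul_assoc, mul_assoc (sign σ'), Int.units_mul_self,
    Int.units_mul_self, one_mul, mul_one]

theorem mem_perfectMatchings [Fintype E] {μ : Finset E} :
    μ ∈ G.perfectMatchings ↔ G.IsPerfectMatching μ := by
  simp [perfectMatchings]

theorem mem_perfectMatchingsVia [Fintype E] {σ : Equiv.Perm (Fin n)} {μ : Finset E} :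
    μ ∈ G.perfectMatchingsVia β ω σ ↔ G.IsPerfectMatching μ ∧ G.MatchesVia β ω σ μ := by
  simp [perfectMatchingsVia, mem_perfectMatchings]

/-- Expanding the product of sums selects one edge for each row, and such selections are the
matchings inducing `σ`. -/
theorem detTerm_signedMatrix [Fintype E] (G : BipartiteGraph B W E) (κ : E → ℤˣ) (β : Fin n ≃ B)
    (ω : Fin n ≃ W) (σ : Equiv.Perm (Fin n)) :
    detTerm (G.signedMatrix κ β ω) σ =
      ∑ μ ∈ G.perfectMatchingsVia β ω σ,
        MvPolynomial.C ((sign σ * ∏ e ∈ μ, κ e : ℤˣ) : ℤ) * monomial μ := by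
  classical
  unfold detTerm signedMatrix
  rw [Finset.prod_univ_sum, Finset.mul_sum]
  refine Finset.sum_bij (fun p _ => Finset.univ.image p) ?_ ?_ ?_ ?_
  · intro p hp
    have hp : G.IsEdgeChoice β ω σ p := fun i => by
      simpa using Fintype.mem_piFinset.1 hp i
    exact mem_perfectMatchingsVia.2 ⟨hp.isPerfectMatching, hp.matchesVia⟩
  · intro p hp q hq hpq
    have hp : G.IsEdgeChoice β ω σ p := fun i => by
      simpa using Fintype.mem_piFinset.1 hp i
    have hq : G.IsEdgeChoice β ω σ q := fun i => by
      simpa using Fintype.mem_piFinset.1 hq i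
    ext1 i
    have : p i ∈ Finset.univ.image q := hpq ▸ Finset.mem_image_of_mem _ (Finset.mem_univ i)
    obtain ⟨j, -, hj⟩ := Finset.mem_image.1 this
    rw [← hj, β.injective ((hq j).1.symm.trans ((congrArg G.black hj).trans (hp i).1))]
  · intro μ hμ
    obtain ⟨h, h'⟩ := mem_perfectMatchingsVia.1 hμ
    obtain ⟨p, hp, rfl⟩ := h.exists_edgeChoice h'
    exact ⟨p, Fintype.mem_piFinset.2 fun i => by simpa using hp i, rfl⟩
  · intro p hp
    have hp : G.IsEdgeChoice β ω σ p := fun i => by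
      simpa using Fintype.mem_piFinset.1 hp i
    rw [monomial, Finset.prod_image hp.injective.injOn, Finset.prod_image hp.injective.injOn,
      Finset.prod_mul_distrib]
    push_cast
    simp [mul_assoc]

theorem sum_monomial_ne_zero [Fintype E] {s : Finset (Finset E)} (hs : s.Nonempty) :
    ∑ μ ∈ s, monomial μ ≠ 0 := by
  intro h
  -- At the all-ones point the sum becomes the number of its terms, so nothing cancels.
  have := congrArg (MvPolynomial.eval fun _ => (1 : ℤ)) h
  simp only [monomial, map_sum, map_prod, MvPolynomial.eval_X, Finset.prod_const_one, map_zero,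
    Finset.sum_const, nsmul_eq_mul, mul_one] at this
  exact hs.card_ne_zero (by exact_mod_cast this)

theorem C_units_mul_ne_zero (ε : ℤˣ) {P : MvPolynomial E ℤ} (hP : P ≠ 0) :
    MvPolynomial.C (ε : ℤ) * P ≠ 0 :=
  mul_ne_zero (by simp) hP

theorem exists_sign [Fintype E] {R : G.RotationSystem} (hR : R.IsPlane) {κ : E → ℤˣ}
    (hκ : R.IsKasteleyn κ) (β : Fin n ≃ B) (ω : Fin n ≃ W) :
    ∃ ε : ℤˣ, ∀ σ : Equiv.Perm (Fin n), ∀ μ ∈ G.perfectMatchingsVia β ω σ,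
      sign σ * ∏ e ∈ μ, κ e = ε := by
  classical
  by_cases h : ∃ σ : Equiv.Perm (Fin n), ∃ μ, μ ∈ G.perfectMatchingsVia β ω σ
  · obtain ⟨σ₀, μ₀, h₀⟩ := h
    refine ⟨sign σ₀ * ∏ e ∈ μ₀, κ e, fun σ μ hμ => ?_⟩
    obtain ⟨h1, h1'⟩ := mem_perfectMatchingsVia.1 hμ
    obtain ⟨h2, h2'⟩ := mem_perfectMatchingsVia.1 h₀
    obtain ⟨p, hp, rfl⟩ := h1.exists_edgeChoice h1'
    obtain ⟨p₀, hp₀, rfl⟩ := h2.exists_edgeChoice h2'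
    rw [Finset.prod_image hp.injective.injOn, Finset.prod_image hp₀.injective.injOn]
    exact sign_mul_prod_eq hR hκ hp hp₀
  · exact ⟨1, fun σ μ hμ => absurd ⟨σ, μ, hμ⟩ h⟩

theorem IsSimple.eq_of_mem_perfectMatchingsVia [Fintype E] (hG : G.IsSimple)
    {σ : Equiv.Perm (Fin n)} {μ μ' : Finset E} (h : μ ∈ G.perfectMatchingsVia β ω σ)
    (h' : μ' ∈ G.perfectMatchingsVia β ω σ) : μ = μ' := by
  classical
  obtain ⟨p, hp, rfl⟩ := (mem_perfectMatchingsVia.1 h).1.exists_edgeChoice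
    (mem_perfectMatchingsVia.1 h).2
  obtain ⟨p', hp', rfl⟩ := (mem_perfectMatchingsVia.1 h').1.exists_edgeChoice
    (mem_perfectMatchingsVia.1 h').2
  congr 1
  ext1 i
  exact hG _ _ ((hp i).1.trans (hp' i).1.symm) ((hp i).2.trans (hp' i).2.symm)

end BipartiteGraph

theorem proposition3p4 {B W E : Type*} [Fintype E] {n : ℕ}
    (G : BipartiteGraph B W E) (β : Fin n ≃ B) (ω : Fin n ≃ W)
    (R : G.RotationSystem) (hR : R.IsPlane)
    (κ : E → ℤˣ) (hκ : R.IsKasteleyn κ) :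
    (∀ σ : Equiv.Perm (Fin n),
      detTerm (G.signedMatrix κ β ω) σ ≠ 0 ↔
        ∃ μ : Finset E, G.IsPerfectMatching μ ∧ G.MatchesVia β ω σ μ) ∧
    (∀ μ : Finset E, G.IsPerfectMatching μ →
      ∃! σ : Equiv.Perm (Fin n), G.MatchesVia β ω σ μ) ∧
    ∃ ε : ℤˣ,
      (∀ σ : Equiv.Perm (Fin n),
        detTerm (G.signedMatrix κ β ω) σ =
          MvPolynomial.C ((ε : ℤˣ) : ℤ) *
            ∑ μ ∈ G.perfectMatchingsVia β ω σ, BipartiteGraph.monomial μ) ∧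
      (G.IsSimple → ∀ σ : Equiv.Perm (Fin n), detTerm (G.signedMatrix κ β ω) σ ≠ 0 →
        ∃! μ : Finset E, (G.IsPerfectMatching μ ∧ G.MatchesVia β ω σ μ) ∧
          detTerm (G.signedMatrix κ β ω) σ =
            MvPolynomial.C ((ε : ℤˣ) : ℤ) * BipartiteGraph.monomial μ) ∧
      (G.signedMatrix κ β ω).det =
        MvPolynomial.C ((ε : ℤˣ) : ℤ) *
          ∑ μ ∈ G.perfectMatchings, BipartiteGraph.monomial μ := by

  classical
  obtain ⟨ε, hε⟩ := BipartiteGraph.exists_sign hR hκ β ω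
  have hterm : ∀ σ : Equiv.Perm (Fin n), detTerm (G.signedMatrix κ β ω) σ =
      MvPolynomial.C ((ε : ℤˣ) : ℤ) *
        ∑ μ ∈ G.perfectMatchingsVia β ω σ, BipartiteGraph.monomial μ := fun σ => by
    rw [BipartiteGraph.detTerm_signedMatrix, Finset.mul_sum]
    exact Finset.sum_congr rfl fun μ hμ => by rw [hε σ μ hμ]
  have hne : ∀ σ : Equiv.Perm (Fin n), detTerm (G.signedMatrix κ β ω) σ ≠ 0 ↔
      ∃ μ : Finset E, G.IsPerfectMatching μ ∧ G.MatchesVia β ω σ μ := fun σ => by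
    rw [hterm]
    constructor
    · intro h
      obtain ⟨μ, hμ⟩ := Finset.nonempty_of_sum_ne_zero (right_ne_zero_of_mul h)
      exact ⟨μ, BipartiteGraph.mem_perfectMatchingsVia.1 hμ⟩
    · rintro ⟨μ, hμ⟩
      exact BipartiteGraph.C_units_mul_ne_zero ε (BipartiteGraph.sum_monomial_ne_zero
        ⟨μ, BipartiteGraph.mem_perfectMatchingsVia.2 hμ⟩)
  refine ⟨hne, fun μ hμ => hμ.existsUnique_matchesVia β ω, ε, hterm, ?_, ?_⟩
  · intro hG σ hσ
    obtain ⟨μ, hμ⟩ := (hne σ).1 hσ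
    have hμ' := BipartiteGraph.mem_perfectMatchingsVia.2 hμ
    refine ⟨μ, ⟨hμ, ?_⟩, fun μ' h => hG.eq_of_mem_perfectMatchingsVia
      (BipartiteGraph.mem_perfectMatchingsVia.2 h.1) hμ'⟩
    rw [hterm, Finset.eq_singleton_iff_unique_mem.2
      ⟨hμ', fun μ' h => hG.eq_of_mem_perfectMatchingsVia h hμ'⟩, Finset.sum_singleton]
  · rw [det_eq_sum_detTerm, Finset.sum_congr rfl fun σ _ => hterm σ, ← Finset.mul_sum]
    congr 1
    -- Exchanging the sums, each perfect matching is counted once, at the one permutation that it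
    -- induces.
    simp only [BipartiteGraph.perfectMatchingsVia, Finset.sum_filter]
    rw [Finset.sum_comm]
    refine Finset.sum_congr rfl fun μ hμ => ?_
    obtain ⟨σ, hσ, hu⟩ :=
      (BipartiteGraph.mem_perfectMatchings.1 hμ).existsUnique_matchesVia β ω
    rw [Finset.sum_eq_single σ (fun τ _ hτ => if_neg fun h => hτ (hu τ h)) (by simp), if_pos hσ]
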